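/- Let $\mathbb{T}=\mathbb{R}/2\pi\mathbb{Z}$ and let $\|\cdot\|_1$ denote the norm of $L_1(\mathbb{T}^2)$ with respect to the normalized Haar measure. A trigonometric polynomial on $\mathbb{T}^2$ is a finite sum $P(x,y)=\sum_{(k,l)\in\mathbb{Z}^2} c_{k,l}\,e^{i(kx+ly)}$ with $c_{k,l}\in\mathbb{C}$; its degree is the largest value of $\max(|k|,|l|)$ over all $(k,l)$ with $c_{k,l}\neq 0$. There is a constant $C>0$ such that for every integer $N\ge 1$ there exists a trigonometric polynomial $P_N$ on $\mathbb{T}^2$ of degree $N$ which satisfies \[ \Big\|\frac{\partial^2}{\partial x^2}P_N\Big\|_1+\Big\|\frac{\partial^2}{\partial y^2}P_N\Big\|_1\le 1 \] but \[ \Big\|\frac{\partial^2}{\partial x\,\partial y}P_N\Big\|_1> C\,(\ln N)^{1/2}. \] -/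

import Mathlib

open MeasureTheory

noncomputable section

/-- The circle `ℝ / 2πℤ`. -/
abbrev Circ : Type := AddCircle (2 * Real.pi)

instance circPeriodPos : Fact (0 < 2 * Real.pi) := ⟨Real.two_pi_pos⟩

/-- The two-dimensional torus `𝕋² = (ℝ / 2πℤ)²`. -/
abbrev Torus2 : Type := Circ × Circ

/-- The normalized Haar measure on `𝕋²` (the product of the Haar probability measures). -/
def torusHaar : Measure Torus2 :=
  (AddCircle.haarAddCircle : Measure Circ).prod (AddCircle.haarAddCircle : Measure Circ)

/-- The `L₁` norm on `𝕋²` with respect to the normalized Haar measure, as an extended real. -/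
def normL1 (f : Torus2 → ℂ) : ENNReal := eLpNorm f 1 torusHaar

/-- The partial derivative in the first variable of a function on the torus. -/
def partialX (f : Torus2 → ℂ) (p : Torus2) : ℂ :=
  deriv (fun t : ℝ => f (p.1 + (t : Circ), p.2)) 0

/-- The partial derivative in the second variable of a function on the torus. -/
def partialY (f : Torus2 → ℂ) (p : Torus2) : ℂ :=
  deriv (fun t : ℝ => f (p.1, p.2 + (t : Circ))) 0

/-- A trigonometric polynomial on `𝕋²`, given by its finitely many nonzero Fourier coefficients
`c (k, l)`, `(k, l) ∈ ℤ²`. -/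
abbrev TrigPoly2 : Type := (ℤ × ℤ) →₀ ℂ

/-- The function `(x, y) ↦ ∑ c (k, l) e^{i (k x + l y)}` on `𝕋²`; for the period `2π`,
`fourier k x` is `e^{i k x}`. -/
def trigFun (c : TrigPoly2) (p : Torus2) : ℂ :=
  c.sum fun k a => a * (fourier k.1 p.1 * fourier k.2 p.2)

/-- The degree: the largest `max (|k|, |l|)` over the frequencies `(k, l)` that occur
(and `0` for the zero polynomial). -/
def trigDegree (c : TrigPoly2) : ℕ :=
  c.support.sup fun k => max k.1.natAbs k.2.natAbs

end

/-!
With `K` a trigonometric polynomial of mean one and `q` large, consider the Riesz products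
`R_j = ∏_{i < j} K(q ^ i (x + (-1) ^ i y))` and, with `S'' = K - 1`, the potential
`∑_{j < n} q ^ (-2 j) R_j S(q ^ j (x + (-1) ^ j y))`. If `K` is bounded below relative to its
derivatives, then `R_j` varies slowly at the scale `q ^ (-j)`, and second derivatives fall on the
last factor up to an error as small as we like. Hence both pure second derivatives are close to
`∑ (R_{j + 1} - R_j) = R_n - R_0`, of norm at most two if `K ≥ 0`, while the mixed one is close to
the alternating sum `∑ (-1) ^ j (R_{j + 1} - R_j)`. The latter has norm at least a constant times
`n` when `K` is nearly a Fejér kernel of degree `2 n`: test it against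
`∑ (-1) ^ j W_j cos(q ^ j (x + (-1) ^ j y))`, where `W_j` is the Riesz product of `(1 + cos) / 2`.
This sum is bounded, because `W_j` decreases and its `j`-th term is `±(2 W_{j + 1} - W_j)`.
The degree is at most `q ^ n` with `q` polynomial in `n`, so the largest admissible `n` exceeds
a multiple of `√(log N)`.
-/

noncomputable section

open Finset AddMonoidAlgebra
open scoped AddMonoidAlgebra ComplexOrder

section Multiplier

variable {G : Type*}

/-- The Fourier multiplier `∑ a_k e_k ↦ ∑ μ_k a_k e_k`. -/
def multiplier (μ : G → ℂ) : ℂ[G] →ₗ[ℂ] ℂ[G] where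
  toFun f := .ofCoeff (μ • f.coeff)
  map_add' f g := by ext; simp
  map_smul' c f := by ext; simp [mul_left_comm]

@[simp]
lemma coeff_multiplier (μ : G → ℂ) (f : ℂ[G]) (k : G) :
    (multiplier μ f).coeff k = μ k * f.coeff k :=
  rfl

@[simp]
lemma multiplier_single (μ : G → ℂ) (k : G) (a : ℂ) :
    multiplier μ (single k a) = single k (μ k * a) := by
  classical
  ext l
  by_cases h : k = l <;> simp [h]

end Multiplier

section GroupAlgebra

variable {G H : Type*} [AddCommGroup G] [AddCommGroup H]

lemma coeff_one_of_ne_zero {k : G} (hk : k ≠ 0) : (1 : ℂ[G]).coeff k = 0 := by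
  rw [one_def, coeff_single, Finsupp.single_eq_of_ne hk]

/-- Evaluation of an element `∑ a_k e_k` of the group algebra at a unitary character `χ`, with
value `∑ a_k χ(k)`. For `G = ℤ × ℤ` these are the values of a trigonometric polynomial. -/
def evalChar (χ : AddChar G Circle) : ℂ[G] →ₐ[ℂ] ℂ :=
  AddMonoidAlgebra.lift ℂ ℂ G (Circle.coeHom.comp χ.toMonoidHom)

@[simp]
lemma evalChar_single (χ : AddChar G Circle) (k : G) (a : ℂ) :
    evalChar χ (single k a) = a * χ k :=
  AddMonoidAlgebra.lift_single ..

lemma evalChar_apply (χ : AddChar G Circle) (f : ℂ[G]) :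
    evalChar χ f = f.coeff.sum fun k a => a * χ k :=
  AddMonoidAlgebra.lift_apply ..

/-- The ring homomorphism `∑ a_k e_k ↦ ∑ a_k e_{φ k}`; on trigonometric polynomials it is the
composition with the homomorphism of tori dual to `φ`. -/
def pullback (φ : H →+ G) : ℂ[H] →ₐ[ℂ] ℂ[G] :=
  mapDomainAlgHom ℂ ℂ φ

@[simp]
lemma pullback_single (φ : H →+ G) (k : H) (a : ℂ) :
    pullback φ (single k a) = single (φ k) a :=
  mapDomain_single

lemma evalChar_pullback (χ : AddChar G Circle) (φ : H →+ G) (f : ℂ[H]) :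
    evalChar χ (pullback φ f) = evalChar (χ.compAddMonoidHom φ) f := by
  induction f using AddMonoidAlgebra.induction_linear with
  | zero => simp
  | add f g hf hg => simp [hf, hg]
  | single k a => simp

/-- The derivation `∑ a_k e_k ↦ ∑ i ℓ(k) a_k e_k`. For `ℓ` a coordinate of `ℤ × ℤ` it is the
partial derivative of trigonometric polynomials in that variable. -/
def charDeriv (ℓ : G →+ ℤ) : Derivation ℂ ℂ[G] ℂ[G] :=
  .mk' (multiplier fun k => Complex.I * ℓ k) fun f g => by
    induction f using AddMonoidAlgebra.induction_linear with
    | zero => simp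
    | add f₁ f₂ h₁ h₂ => simp only [map_add, add_mul, h₁, h₂, add_smul, smul_add]; ring
    | single k a =>
      induction g using AddMonoidAlgebra.induction_linear with
      | zero => simp
      | add g₁ g₂ h₁ h₂ => simp only [map_add, mul_add, h₁, h₂, add_smul, smul_add]; ring
      | single l b =>
        simp only [single_mul_single, multiplier_single, smul_eq_mul]
        rw [add_comm l k, ← single_add, map_add]
        push_cast
        ring_nf

@[simp]
lemma coeff_charDeriv (ℓ : G →+ ℤ) (f : ℂ[G]) (k : G) :
    (charDeriv ℓ f).coeff k = Complex.I * ℓ k * f.coeff k :=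
  rfl

@[simp]
lemma charDeriv_single (ℓ : G →+ ℤ) (k : G) (a : ℂ) :
    charDeriv ℓ (single k a) = single k (Complex.I * ℓ k * a) :=
  multiplier_single ..

lemma charDeriv_pullback {ℓ : G →+ ℤ} {φ : H →+ G} {ℓ₀ : H →+ ℤ} {c : ℤ}
    (h : ∀ k, ℓ (φ k) = c * ℓ₀ k) (f : ℂ[H]) :
    charDeriv ℓ (pullback φ f) = (c : ℂ) • pullback φ (charDeriv ℓ₀ f) := by
  induction f using AddMonoidAlgebra.induction_linear with
  | zero => simp
  | add f g hf hg => simp only [map_add, hf, hg, smul_add]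
  | single k a =>
    simp only [pullback_single, charDeriv_single, h, smul_single, smul_eq_mul]
    push_cast
    ring_nf

end GroupAlgebra

section BandLimited

variable {G H : Type*} [SeminormedAddCommGroup G] [SeminormedAddCommGroup H]

/-- The elements of the group algebra whose frequencies have norm at most `d`. On `ℤ × ℤ`, with its
supremum norm, these are the trigonometric polynomials of degree at most `d`. -/
def bandLimited (G : Type*) [SeminormedAddCommGroup G] (d : ℝ) : Submodule ℂ ℂ[G] :=
  supported ℂ ℂ {k | ‖k‖ ≤ d}

lemma mem_bandLimited {d : ℝ} {f : ℂ[G]} :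
    f ∈ bandLimited G d ↔ ∀ k, d < ‖k‖ → f.coeff k = 0 := by
  simp [bandLimited, mem_supported']

lemma bandLimited_mono {d e : ℝ} (h : d ≤ e) : bandLimited G d ≤ bandLimited G e :=
  supported_mono fun _ hk => le_trans hk h

lemma single_mem_bandLimited {d : ℝ} {k : G} (h : ‖k‖ ≤ d) (a : ℂ) :
    single k a ∈ bandLimited G d := by
  classical
  refine mem_bandLimited.2 fun l hl => ?_
  rw [coeff_single, Finsupp.single_apply, if_neg]
  rintro rfl
  exact hl.not_ge h

lemma one_mem_bandLimited {d : ℝ} (hd : 0 ≤ d) : (1 : ℂ[G]) ∈ bandLimited G d :=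
  single_mem_bandLimited (by simpa using hd) 1

lemma mul_mem_bandLimited {d e : ℝ} {f g : ℂ[G]} (hf : f ∈ bandLimited G d)
    (hg : g ∈ bandLimited G e) : f * g ∈ bandLimited G (d + e) := by
  classical
  intro k hk
  obtain ⟨a, ha, b, hb, rfl⟩ := mem_add.1 (support_coeff_mul_subset f g hk)
  exact (norm_add_le a b).trans (add_le_add (hf ha) (hg hb))

lemma prod_mem_bandLimited {ι : Type*} (s : Finset ι) {d : ι → ℝ} {f : ι → ℂ[G]}
    (hf : ∀ i ∈ s, f i ∈ bandLimited G (d i)) : ∏ i ∈ s, f i ∈ bandLimited G (∑ i ∈ s, d i) := by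
  classical
  induction s using Finset.induction_on with
  | empty => simpa using one_mem_bandLimited le_rfl
  | insert i s hi ih =>
    rw [prod_insert hi, sum_insert hi]
    exact mul_mem_bandLimited (hf i (mem_insert_self i s))
      (ih fun j hj => hf j (mem_insert_of_mem hj))

lemma multiplier_mem_bandLimited (μ : G → ℂ) {d : ℝ} {f : ℂ[G]} (hf : f ∈ bandLimited G d) :
    multiplier μ f ∈ bandLimited G d :=
  mem_bandLimited.2 fun k hk => by simp [mem_bandLimited.1 hf k hk]

lemma charDeriv_mem_bandLimited (ℓ : G →+ ℤ) {d : ℝ} {f : ℂ[G]} (hf : f ∈ bandLimited G d) :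
    charDeriv ℓ f ∈ bandLimited G d :=
  multiplier_mem_bandLimited _ hf

lemma pullback_mem_bandLimited {φ : H →+ G} {c d : ℝ} (hc : 0 ≤ c) (hφ : ∀ k, ‖φ k‖ ≤ c * ‖k‖)
    {f : ℂ[H]} (hf : f ∈ bandLimited H d) : pullback φ f ∈ bandLimited G (c * d) := by
  classical
  intro k hk
  obtain ⟨l, hl, rfl⟩ := mem_image.1 (Finsupp.mapDomain_support hk)
  exact (hφ l).trans (mul_le_mul_of_nonneg_left (hf hl) hc)

/-- Frequencies of `f` are too small to cancel a nonzero frequency of `pullback φ g`. -/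
lemma coeff_zero_mul_pullback {φ : H →+ G} {d : ℝ} (hφ : ∀ k ≠ 0, d < ‖φ k‖) {f : ℂ[G]}
    (hf : f ∈ bandLimited G d) (g : ℂ[H]) :
    (f * pullback φ g).coeff 0 = f.coeff 0 * g.coeff 0 := by
  classical
  induction g using AddMonoidAlgebra.induction_linear with
  | zero => simp
  | add g₁ g₂ h₁ h₂ => simp [mul_add, h₁, h₂]
  | single k a =>
    rcases eq_or_ne k 0 with rfl | hk
    · simp [coeff_mul_single_apply]
    · have : f.coeff (-φ k) = 0 := mem_bandLimited.1 hf _ (by simpa using hφ k hk)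
      simp [coeff_mul_single_apply, hk, this]

lemma norm_evalChar_le_of_mem_bandLimited {f : ℂ[ℤ]} {m : ℕ} {B : ℝ} (hf : f ∈ bandLimited ℤ m)
    (hB : ∀ k, ‖f.coeff k‖ ≤ B) (χ : AddChar ℤ Circle) : ‖evalChar χ f‖ ≤ (2 * m + 1) * B := by
  have h_supp : f.coeff.support ⊆ Icc (-m : ℤ) m := fun k hk => by
    have : ‖k‖ ≤ m := hf hk
    rw [Int.norm_eq_abs] at this
    exact mem_Icc.2 (abs_le.1 (by exact_mod_cast this))
  have h_card : #(Icc (-m : ℤ) m) = 2 * m + 1 := by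
    rw [Int.card_Icc]
    lia
  rw [evalChar_apply, Finsupp.sum_of_support_subset _ h_supp _ (by simp)]
  refine (norm_sum_le_of_le _ fun k _ => ?_).trans_eq (b := ∑ _ ∈ Icc (-m : ℤ) m, B) ?_
  · simpa [Circle.norm_coe] using hB k
  · simp [h_card]

lemma norm_coeff_charDeriv_le_of_mem_bandLimited {f : ℂ[ℤ]} {m : ℕ} {B : ℝ}
    (hf : f ∈ bandLimited ℤ m) (hB : ∀ k, ‖f.coeff k‖ ≤ B) (k : ℤ) :
    ‖(charDeriv (.id ℤ) f).coeff k‖ ≤ m * B := by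
  have hB₀ : 0 ≤ B := (norm_nonneg _).trans (hB 0)
  obtain hk | hk := le_or_gt ‖k‖ m
  · rw [coeff_charDeriv, norm_mul, norm_mul, Complex.norm_I, one_mul, AddMonoidHom.id_apply,
      Complex.norm_intCast, ← Int.norm_eq_abs]
    gcongr
    exact hB k
  · rw [coeff_charDeriv, mem_bandLimited.1 hf k hk, mul_zero, norm_zero]
    positivity

end BandLimited

/-- The character `(k, l) ↦ e^{i(kx + ly)}` of `ℤ × ℤ` given by a point `(x, y)` of the torus. -/
def torusChar (p : Torus2) : AddChar (ℤ × ℤ) Circle where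
  toFun k := AddCircle.toCircle (k.1 • p.1) * AddCircle.toCircle (k.2 • p.2)
  map_zero_eq_one' := by simp
  map_add_eq_mul' k l := by
    simp only [Prod.fst_add, Prod.snd_add, add_smul, AddCircle.toCircle_add]
    exact mul_mul_mul_comm ..

lemma coe_torusChar (p : Torus2) (k : ℤ × ℤ) :
    (torusChar p k : ℂ) = fourier k.1 p.1 * fourier k.2 p.2 :=
  rfl

lemma trigFun_coeff (f : ℂ[ℤ × ℤ]) (p : Torus2) :
    trigFun f.coeff p = evalChar (torusChar p) f := by
  rw [evalChar_apply]
  rfl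

lemma continuous_evalChar_torusChar (f : ℂ[ℤ × ℤ]) :
    Continuous fun p => evalChar (torusChar p) f := by
  induction f using AddMonoidAlgebra.induction_linear with
  | zero => simpa using continuous_const
  | add f g hf hg =>
    simp only [map_add]
    exact hf.add hg
  | single k a =>
    simp only [evalChar_single, coe_torusChar]
    fun_prop

lemma hasDerivAt_evalChar_torusChar {c : ℝ → Torus2} {ℓ : ℤ × ℤ →+ ℤ} {t : ℝ}
    (h : ∀ k, HasDerivAt (fun s => (torusChar (c s) k : ℂ))
      (Complex.I * ℓ k * torusChar (c t) k) t) (f : ℂ[ℤ × ℤ]) :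
    HasDerivAt (fun s => evalChar (torusChar (c s)) f)
      (evalChar (torusChar (c t)) (charDeriv ℓ f)) t := by
  induction f using AddMonoidAlgebra.induction_linear with
  | zero => simpa using hasDerivAt_const t (0 : ℂ)
  | add f g hf hg =>
    simp only [map_add]
    exact hf.add hg
  | single k a =>
    simp only [evalChar_single, charDeriv_single]
    exact ((h k).const_mul a).congr_deriv (by ring)

lemma hasDerivAt_fourier_add_coe (n : ℤ) (x : Circ) :
    HasDerivAt (fun t : ℝ => (fourier n (x + (t : Circ)) : ℂ)) (Complex.I * n * fourier n x) 0 := by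
  have h_add (t : ℝ) : (fourier n (x + (t : Circ)) : ℂ) = fourier n x * fourier n (t : Circ) := by
    simp only [fourier_apply, smul_add, AddCircle.toCircle_add, Circle.coe_mul]
  have h_pi : (Real.pi : ℂ) ≠ 0 := by exact_mod_cast Real.pi_ne_zero
  simp_rw [h_add]
  refine ((hasDerivAt_fourier (2 * Real.pi) n 0).const_mul _).congr_deriv ?_
  rw [AddCircle.coe_zero, fourier_eval_zero]
  push_cast
  field_simp

/-- The partial derivative `∂/∂x` of trigonometric polynomials. -/
abbrev derivX : Derivation ℂ ℂ[ℤ × ℤ] ℂ[ℤ × ℤ] := charDeriv (.fst ℤ ℤ)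

/-- The partial derivative `∂/∂y` of trigonometric polynomials. -/
abbrev derivY : Derivation ℂ ℂ[ℤ × ℤ] ℂ[ℤ × ℤ] := charDeriv (.snd ℤ ℤ)

lemma partialX_trigFun (f : ℂ[ℤ × ℤ]) :
    partialX (trigFun f.coeff) = trigFun (derivX f).coeff := by
  funext p
  have h := hasDerivAt_evalChar_torusChar (c := fun t => (p.1 + (t : Circ), p.2)) (t := 0)
    (ℓ := .fst ℤ ℤ) (fun k => ?_) f
  · simpa [partialX, trigFun_coeff] using h.deriv
  · simpa [coe_torusChar, mul_assoc] using
      (hasDerivAt_fourier_add_coe k.1 p.1).mul_const (fourier k.2 p.2)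

lemma partialY_trigFun (f : ℂ[ℤ × ℤ]) :
    partialY (trigFun f.coeff) = trigFun (derivY f).coeff := by
  funext p
  have h := hasDerivAt_evalChar_torusChar (c := fun t => (p.1, p.2 + (t : Circ))) (t := 0)
    (ℓ := .snd ℤ ℤ) (fun k => ?_) f
  · simpa [partialY, trigFun_coeff] using h.deriv
  · simpa [coe_torusChar, mul_left_comm] using
      (hasDerivAt_fourier_add_coe k.2 p.2).const_mul (fourier k.1 p.1)

instance : IsProbabilityMeasure torusHaar :=
  inferInstanceAs (IsProbabilityMeasure (Measure.prod _ _))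

lemma integrable_evalChar_torusChar (f : ℂ[ℤ × ℤ]) :
    Integrable (fun p => evalChar (torusChar p) f) torusHaar :=
  (continuous_evalChar_torusChar f).integrable_of_hasCompactSupport (.of_compactSpace _)

lemma integral_fourier (n : ℤ) :
    ∫ x : Circ, fourier n x ∂AddCircle.haarAddCircle = if n = 0 then 1 else 0 := by
  simpa [fourierCoeff, Pi.single_apply, eq_comm] using
    congrFun (fourierCoeff_fourier (T := 2 * Real.pi) n) 0

lemma integral_evalChar_torusChar (f : ℂ[ℤ × ℤ]) :
    ∫ p, evalChar (torusChar p) f ∂torusHaar = f.coeff 0 := by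
  induction f using AddMonoidAlgebra.induction_linear with
  | zero => simp
  | add f g hf hg =>
    simp only [map_add, coeff_add, Finsupp.add_apply]
    rw [integral_add (integrable_evalChar_torusChar f) (integrable_evalChar_torusChar g), hf, hg]
  | single k a =>
    simp only [evalChar_single, coe_torusChar]
    rw [integral_const_mul, torusHaar,
      integral_prod_mul (fun x : Circ => (fourier k.1 x : ℂ)) fun y : Circ => (fourier k.2 y : ℂ),
      integral_fourier, integral_fourier, coeff_single, Finsupp.single_apply]
    obtain ⟨k, l⟩ := k
    by_cases hk : k = 0 <;> by_cases hl : l = 0 <;> simp [hk, hl]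

/-- The `L₁` norm of a trigonometric polynomial, as a real seminorm. -/
def l1Norm : Seminorm ℂ ℂ[ℤ × ℤ] :=
  .of (fun f => ∫ p, ‖evalChar (torusChar p) f‖ ∂torusHaar)
    (fun f g => by
      rw [← integral_add (integrable_evalChar_torusChar f).norm
        (integrable_evalChar_torusChar g).norm]
      exact integral_mono (integrable_evalChar_torusChar _).norm
        ((integrable_evalChar_torusChar f).norm.add (integrable_evalChar_torusChar g).norm)
        fun p => by simpa using norm_add_le (evalChar (torusChar p) f) (evalChar (torusChar p) g))
    fun c f => by simp [integral_const_mul]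

lemma l1Norm_apply (f : ℂ[ℤ × ℤ]) : l1Norm f = ∫ p, ‖evalChar (torusChar p) f‖ ∂torusHaar :=
  rfl

lemma normL1_trigFun (f : ℂ[ℤ × ℤ]) : normL1 (trigFun f.coeff) = ENNReal.ofReal (l1Norm f) := by
  have h := integrable_evalChar_torusChar f
  rw [normL1, funext (trigFun_coeff f), eLpNorm_one_eq_lintegral_enorm, l1Norm_apply,
    ofReal_integral_norm_eq_lintegral_enorm h]

lemma l1Norm_single (k : ℤ × ℤ) (a : ℂ) : l1Norm (single k a) = ‖a‖ := by
  simp [l1Norm_apply, Circle.norm_coe]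

lemma l1Norm_le_mul_of_norm_le {f g : ℂ[ℤ × ℤ]} {C : ℝ}
    (h : ∀ χ, ‖evalChar χ f‖ ≤ C * ‖evalChar χ g‖) : l1Norm f ≤ C * l1Norm g := by
  rw [l1Norm_apply, l1Norm_apply, ← integral_const_mul]
  exact integral_mono (integrable_evalChar_torusChar f).norm
    ((integrable_evalChar_torusChar g).norm.const_mul C) fun p => h _

lemma norm_coeff_zero_le_l1Norm (f : ℂ[ℤ × ℤ]) : ‖f.coeff 0‖ ≤ l1Norm f := by
  rw [← integral_evalChar_torusChar]
  exact norm_integral_le_integral_norm _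

lemma norm_coeff_zero_mul_le {f g : ℂ[ℤ × ℤ]} {C : ℝ} (h : ∀ χ, ‖evalChar χ g‖ ≤ C) :
    ‖(g * f).coeff 0‖ ≤ C * l1Norm f := by
  refine (norm_coeff_zero_le_l1Norm _).trans (l1Norm_le_mul_of_norm_le fun χ => ?_)
  rw [map_mul, norm_mul]
  exact mul_le_mul_of_nonneg_right (h χ) (norm_nonneg _)

lemma norm_coeff_le_l1Norm (f : ℂ[ℤ × ℤ]) (k : ℤ × ℤ) : ‖f.coeff k‖ ≤ l1Norm f := by
  have h := norm_coeff_zero_mul_le (f := f) (g := single (-k) 1) (C := 1) fun χ => by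
    simpa using (Circle.norm_coe _).le
  simpa [coeff_single_mul_apply] using h

lemma l1Norm_of_nonneg {f : ℂ[ℤ × ℤ]} (h : ∀ χ, 0 ≤ evalChar χ f) :
    (l1Norm f : ℂ) = f.coeff 0 := by
  rw [l1Norm_apply, ← integral_evalChar_torusChar, ← integral_complex_ofReal]
  exact integral_congr_ae (.of_forall fun p => (Complex.eq_coe_norm_of_nonneg (h _)).symm)

lemma trigDegree_le_of_mem_bandLimited {f : ℂ[ℤ × ℤ]} {d : ℕ}
    (h : f ∈ bandLimited (ℤ × ℤ) d) : trigDegree f.coeff ≤ d := by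
  refine Finset.sup_le fun k hk => ?_
  have hk : ‖k‖ ≤ d := h hk
  have natAbs_le {n : ℤ} (hn : ‖n‖ ≤ d) : n.natAbs ≤ d := by
    rwa [← Nat.cast_le (α := ℝ), Nat.cast_natAbs, Int.cast_abs, ← Int.norm_eq_abs]
  exact max_le (natAbs_le ((norm_fst_le k).trans hk)) (natAbs_le ((norm_snd_le k).trans hk))

section Tame

variable {G H : Type*} [AddCommGroup G] [AddCommGroup H]

/-- `f` dominates pointwise its derivatives of order at most two along `ℓ` and `ℓ'`, with constant
`C` per derivative. The point of the notion is that the constants add up under products. -/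
structure IsTame (ℓ ℓ' : G →+ ℤ) (C : ℝ) (f : ℂ[G]) : Prop where
  nonneg : 0 ≤ C
  left (χ : AddChar G Circle) : ‖evalChar χ (charDeriv ℓ f)‖ ≤ C * ‖evalChar χ f‖
  right (χ : AddChar G Circle) : ‖evalChar χ (charDeriv ℓ' f)‖ ≤ C * ‖evalChar χ f‖
  mixed (χ : AddChar G Circle) :
    ‖evalChar χ (charDeriv ℓ (charDeriv ℓ' f))‖ ≤ C ^ 2 * ‖evalChar χ f‖

lemma charDeriv_charDeriv_mul (ℓ ℓ' : G →+ ℤ) (f g : ℂ[G]) :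
    charDeriv ℓ (charDeriv ℓ' (f * g)) =
      charDeriv ℓ (charDeriv ℓ' f) * g + charDeriv ℓ f * charDeriv ℓ' g +
        charDeriv ℓ' f * charDeriv ℓ g + f * charDeriv ℓ (charDeriv ℓ' g) := by
  simp only [Derivation.leibniz, map_add, smul_eq_mul]
  ring

namespace IsTame

variable {ℓ ℓ' : G →+ ℤ} {C C' : ℝ} {f g : ℂ[G]}

lemma mono (hf : IsTame ℓ ℓ' C f) (h : C ≤ C') : IsTame ℓ ℓ' C' f where
  nonneg := hf.nonneg.trans h
  left χ := (hf.left χ).trans (by gcongr)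
  right χ := (hf.right χ).trans (by gcongr)
  mixed χ := (hf.mixed χ).trans (by have := hf.nonneg; gcongr)

lemma one : IsTame ℓ ℓ' 0 (1 : ℂ[G]) := by
  constructor <;> simp

lemma mul (hf : IsTame ℓ ℓ' C f) (hg : IsTame ℓ ℓ' C' g) : IsTame ℓ ℓ' (C + C') (f * g) := by
  have hC := hf.nonneg
  have hC' := hg.nonneg
  have first_order {l : G →+ ℤ} (χ : AddChar G Circle)
      (hf : ‖evalChar χ (charDeriv l f)‖ ≤ C * ‖evalChar χ f‖)
      (hg : ‖evalChar χ (charDeriv l g)‖ ≤ C' * ‖evalChar χ g‖) :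
      ‖evalChar χ (charDeriv l (f * g))‖ ≤ (C + C') * ‖evalChar χ (f * g)‖ := by
    calc ‖evalChar χ (charDeriv l (f * g))‖
      _ ≤ ‖evalChar χ f‖ * ‖evalChar χ (charDeriv l g)‖ +
          ‖evalChar χ g‖ * ‖evalChar χ (charDeriv l f)‖ := by
        simpa using norm_add_le (evalChar χ (f * charDeriv l g)) (evalChar χ (g * charDeriv l f))
      _ ≤ ‖evalChar χ f‖ * (C' * ‖evalChar χ g‖) + ‖evalChar χ g‖ * (C * ‖evalChar χ f‖) := by
        gcongr
      _ = (C + C') * ‖evalChar χ (f * g)‖ := by rw [map_mul, norm_mul]; ring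
  refine ⟨add_nonneg hC hC', fun χ => first_order χ (hf.left χ) (hg.left χ),
    fun χ => first_order χ (hf.right χ) (hg.right χ), fun χ => ?_⟩
  simp only [charDeriv_charDeriv_mul, map_add, map_mul]
  refine norm_add₄_le.trans ?_
  simp only [norm_mul]
  calc
    _ ≤ C ^ 2 * ‖evalChar χ f‖ * ‖evalChar χ g‖ +
        C * ‖evalChar χ f‖ * (C' * ‖evalChar χ g‖) +
        C * ‖evalChar χ f‖ * (C' * ‖evalChar χ g‖) +
        ‖evalChar χ f‖ * (C' ^ 2 * ‖evalChar χ g‖) := by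
      gcongr
      exacts [hf.mixed χ, hf.left χ, hg.right χ, hf.right χ, hg.left χ, hg.mixed χ]
    _ = (C + C') ^ 2 * (‖evalChar χ f‖ * ‖evalChar χ g‖) := by ring

lemma prod {ι : Type*} (s : Finset ι) {C : ι → ℝ} {f : ι → ℂ[G]}
    (hf : ∀ i ∈ s, IsTame ℓ ℓ' (C i) (f i)) : IsTame ℓ ℓ' (∑ i ∈ s, C i) (∏ i ∈ s, f i) := by
  classical
  induction s using Finset.induction_on with
  | empty => simpa using one
  | insert i s hi ih =>
    rw [prod_insert hi, sum_insert hi]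
    exact (hf i (mem_insert_self i s)).mul (ih fun j hj => hf j (mem_insert_of_mem hj))

lemma pullback {φ : H →+ G} {ℓ₀ ℓ₀' : H →+ ℤ} {c c' : ℤ} {B : ℝ} {f : ℂ[H]}
    (hf : IsTame ℓ₀ ℓ₀' C f) (hℓ : ∀ k, ℓ (φ k) = c * ℓ₀ k) (hℓ' : ∀ k, ℓ' (φ k) = c' * ℓ₀' k)
    (hc : |(c : ℝ)| ≤ B) (hc' : |(c' : ℝ)| ≤ B) : IsTame ℓ ℓ' (B * C) (pullback φ f) := by
  have hC := hf.nonneg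
  have hB : 0 ≤ B := (abs_nonneg _).trans hc
  refine ⟨mul_nonneg hB hC, fun χ => ?_, fun χ => ?_, fun χ => ?_⟩
  · rw [charDeriv_pullback hℓ, map_smul, norm_smul, evalChar_pullback, evalChar_pullback,
      Complex.norm_intCast, mul_assoc]
    gcongr
    exact hf.left _
  · rw [charDeriv_pullback hℓ', map_smul, norm_smul, evalChar_pullback, evalChar_pullback,
      Complex.norm_intCast, mul_assoc]
    gcongr
    exact hf.right _
  · rw [charDeriv_pullback hℓ', Derivation.map_smul, charDeriv_pullback hℓ, smul_smul, map_smul,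
      norm_smul, evalChar_pullback, evalChar_pullback, norm_mul, Complex.norm_intCast,
      Complex.norm_intCast]
    calc |(c' : ℝ)| * |(c : ℝ)| * ‖_‖
      _ ≤ B * B * (C ^ 2 * ‖evalChar (χ.compAddMonoidHom φ) f‖) := by
        gcongr
        exact hf.mixed _
      _ = (B * C) ^ 2 * ‖evalChar (χ.compAddMonoidHom φ) f‖ := by ring

end IsTame

/-- If `R` oscillates at frequencies much smaller than the scale `N` of `φ`, then the derivatives of
`R * pullback φ S` essentially fall on the second factor. -/
lemma norm_evalChar_deriv_mul_pullback_sub_le {ℓ ℓ' : G →+ ℤ} {φ : H →+ G} {ℓ₀ : H →+ ℤ}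
    {c c' : ℤ} {N κ A : ℝ} {S : ℂ[H]} {R : ℂ[G]}
    (hℓ : ∀ k, ℓ (φ k) = c * ℓ₀ k) (hℓ' : ∀ k, ℓ' (φ k) = c' * ℓ₀ k)
    (hc : |(c : ℝ)| ≤ N) (hc' : |(c' : ℝ)| ≤ N) (hS : ∀ χ, ‖evalChar χ S‖ ≤ A)
    (hDS : ∀ χ, ‖evalChar χ (charDeriv ℓ₀ S)‖ ≤ A) (hR : IsTame ℓ ℓ' (κ * N) R)
    (χ : AddChar G Circle) :
    ‖evalChar χ (charDeriv ℓ (charDeriv ℓ' (R * pullback φ S)) -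
        (c * c' : ℂ) • (R * pullback φ (charDeriv ℓ₀ (charDeriv ℓ₀ S))))‖ ≤
      N ^ 2 * (A * (2 * κ + κ ^ 2)) * ‖evalChar χ R‖ := by
  have hN : 0 ≤ N := (abs_nonneg _).trans hc
  have hA : 0 ≤ A := (norm_nonneg _).trans (hS (χ.compAddMonoidHom φ))
  have h_expand : charDeriv ℓ (charDeriv ℓ' (R * pullback φ S)) -
      (c * c' : ℂ) • (R * pullback φ (charDeriv ℓ₀ (charDeriv ℓ₀ S))) =
      (c : ℂ) • (pullback φ (charDeriv ℓ₀ S) * charDeriv ℓ' R) +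
        (c' : ℂ) • (pullback φ (charDeriv ℓ₀ S) * charDeriv ℓ R) +
        pullback φ S * charDeriv ℓ (charDeriv ℓ' R) := by
    rw [mul_comm R, mul_comm R, charDeriv_charDeriv_mul, charDeriv_pullback hℓ,
      charDeriv_pullback hℓ', Derivation.map_smul, charDeriv_pullback hℓ, smul_smul]
    simp only [smul_mul_assoc, mul_comm (c : ℂ)]
    abel
  rw [h_expand]
  simp only [map_add, map_smul, map_mul, evalChar_pullback]
  refine norm_add₃_le.trans ?_
  simp only [norm_smul, norm_mul, Complex.norm_intCast]
  calc
    _ ≤ N * (A * (κ * N * ‖evalChar χ R‖)) + N * (A * (κ * N * ‖evalChar χ R‖)) +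
        A * ((κ * N) ^ 2 * ‖evalChar χ R‖) := by
      gcongr
      exacts [hDS _, hR.right χ, hDS _, hR.left χ, hS _, hR.mixed χ]
    _ = N ^ 2 * (A * (2 * κ + κ ^ 2)) * ‖evalChar χ R‖ := by ring

end Tame

section RieszProducts

variable {q : ℕ}

/-- The homomorphism `k ↦ (q ^ j k, (-q) ^ j k)`, so that `pullback (phase q j)` substitutes
`q ^ j (x + (-1) ^ j y)` into a trigonometric polynomial of one variable. -/
def phase (q j : ℕ) : ℤ →+ ℤ × ℤ :=
  (AddMonoidHom.mulLeft ((q : ℤ) ^ j)).prod (AddMonoidHom.mulLeft ((-q : ℤ) ^ j))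

@[simp]
lemma phase_apply (q j : ℕ) (k : ℤ) : phase q j k = ((q : ℤ) ^ j * k, (-q : ℤ) ^ j * k) :=
  rfl

lemma fst_phase (q j : ℕ) (k : ℤ) :
    AddMonoidHom.fst ℤ ℤ (phase q j k) = ((1 : ℤˣ) * q) ^ j * k := by
  simp

lemma snd_phase (q j : ℕ) (k : ℤ) :
    AddMonoidHom.snd ℤ ℤ (phase q j k) = ((-1 : ℤˣ) * q) ^ j * k := by
  simp

lemma norm_phase (q j : ℕ) (k : ℤ) : ‖phase q j k‖ = (q : ℝ) ^ j * ‖k‖ := by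
  simp [Prod.norm_def, Int.norm_eq_abs]

/-- The Riesz product `∏_{i < n} f(q ^ i (x + (-1) ^ i y))`. -/
def rieszProd (q : ℕ) (f : ℂ[ℤ]) (n : ℕ) : ℂ[ℤ × ℤ] :=
  ∏ i ∈ range n, pullback (phase q i) f

@[simp]
lemma rieszProd_zero (q : ℕ) (f : ℂ[ℤ]) : rieszProd q f 0 = 1 :=
  prod_range_zero _

lemma rieszProd_succ (q : ℕ) (f : ℂ[ℤ]) (n : ℕ) :
    rieszProd q f (n + 1) = rieszProd q f n * pullback (phase q n) f :=
  prod_range_succ ..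

/-- The `k`-th factor `u` of a Riesz product, replaced by `f`, in the partial product ending there.
When `f` has mean zero these are the analogues of martingale increments. -/
def rieszIncrement (q : ℕ) (u f : ℂ[ℤ]) (k : ℕ) : ℂ[ℤ × ℤ] :=
  rieszProd q u k * pullback (phase q k) f

lemma rieszProd_succ_sub (q : ℕ) (f : ℂ[ℤ]) (n : ℕ) :
    rieszProd q f (n + 1) - rieszProd q f n = rieszIncrement q f (f - 1) n := by
  rw [rieszProd_succ, rieszIncrement, map_sub, map_one]
  ring

lemma rieszProd_mul (q : ℕ) (f g : ℂ[ℤ]) (n : ℕ) :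
    rieszProd q (f * g) n = rieszProd q f n * rieszProd q g n := by
  simp [rieszProd, prod_mul_distrib]

lemma sum_range_mul_pow_le {b κ q : ℝ} (hq : 0 ≤ q) (h : b ≤ κ * (q - 1)) (n : ℕ) :
    ∑ i ∈ range n, b * q ^ i ≤ κ * (q ^ n - 1) := by
  calc
    _ ≤ ∑ i ∈ range n, κ * (q - 1) * q ^ i := by gcongr
    _ = κ * (q ^ n - 1) := by rw [← mul_sum, mul_assoc, mul_geom_sum]

lemma rieszProd_mem_bandLimited {f : ℂ[ℤ]} {d δ : ℝ} (hf : f ∈ bandLimited ℤ d)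
    (hq : d ≤ δ * (q - 1)) (n : ℕ) :
    rieszProd q f n ∈ bandLimited (ℤ × ℤ) (δ * (q ^ n - 1)) := by
  have h_factor (i : ℕ) : pullback (phase q i) f ∈ bandLimited (ℤ × ℤ) (d * q ^ i) := by
    rw [mul_comm]
    exact pullback_mem_bandLimited (by positivity) (fun k => (norm_phase q i k).le) hf
  exact bandLimited_mono (sum_range_mul_pow_le q.cast_nonneg hq n)
    (prod_mem_bandLimited _ fun i _ => h_factor i)

lemma rieszIncrement_mem_bandLimited {u f : ℂ[ℤ]} {d δ : ℝ} (hu : u ∈ bandLimited ℤ d)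
    (hf : f ∈ bandLimited ℤ d) (hq : d ≤ δ * (q - 1)) (k : ℕ) :
    rieszIncrement q u f k ∈ bandLimited (ℤ × ℤ) (δ * (q ^ (k + 1) - 1)) := by
  refine bandLimited_mono ?_ (mul_mem_bandLimited (rieszProd_mem_bandLimited hu hq k)
    (pullback_mem_bandLimited (by positivity) (fun l => (norm_phase q k l).le) hf))
  have : (q : ℝ) ^ k * d ≤ q ^ k * (δ * (q - 1)) := by gcongr
  rw [pow_succ]
  linarith

lemma coeff_zero_mul_pullback_phase {h : ℂ[ℤ × ℤ]} {d : ℝ} {j : ℕ}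
    (hh : h ∈ bandLimited (ℤ × ℤ) d) (hd : d < q ^ j) (f : ℂ[ℤ]) :
    (h * pullback (phase q j) f).coeff 0 = h.coeff 0 * f.coeff 0 := by
  refine coeff_zero_mul_pullback (fun k hk => ?_) hh f
  have h_one : 1 ≤ ‖k‖ := by
    rw [Int.norm_eq_abs]
    exact_mod_cast Int.one_le_abs hk
  rw [norm_phase]
  exact hd.trans_le (le_mul_of_one_le_right (by positivity) h_one)

lemma coeff_zero_rieszProd {f : ℂ[ℤ]} {d : ℝ} (hf : f ∈ bandLimited ℤ d) (hq : 2 * d + 1 ≤ q)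
    (n : ℕ) : (rieszProd q f n).coeff 0 = f.coeff 0 ^ n := by
  induction n with
  | zero => simp
  | succ n ih =>
    have h_band := rieszProd_mem_bandLimited (q := q) (δ := 1 / 2) hf (by linarith) n
    have h_pow : (0 : ℝ) ≤ q ^ n := by positivity
    rw [rieszProd_succ, coeff_zero_mul_pullback_phase h_band (by linarith), ih, pow_succ]

/-- A nonnegative trigonometric polynomial of mean one and degree at most `d`, as used to build
Riesz products. -/
structure IsKernel (d : ℕ) (K : ℂ[ℤ]) : Prop where
  nonneg (χ : AddChar ℤ Circle) : 0 ≤ evalChar χ K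
  coeff_zero : K.coeff 0 = 1
  mem_bandLimited : K ∈ bandLimited ℤ d

lemma IsKernel.l1Norm_rieszProd {d : ℕ} {K : ℂ[ℤ]} (hK : IsKernel d K) (hq : 2 * d + 1 ≤ q)
    (n : ℕ) : l1Norm (rieszProd q K n) = 1 := by
  have h_prod (χ : AddChar (ℤ × ℤ) Circle) : 0 ≤ evalChar χ (rieszProd q K n) := by
    simp only [rieszProd, map_prod, evalChar_pullback]
    exact prod_nonneg fun _ _ => hK.nonneg _
  have h := l1Norm_of_nonneg h_prod
  rw [coeff_zero_rieszProd hK.mem_bandLimited (by exact_mod_cast hq), hK.coeff_zero, one_pow] at h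
  exact_mod_cast h

section Orthogonality

variable {u f v g : ℂ[ℤ]} {d : ℕ} (hu : u ∈ bandLimited ℤ d) (hf : f ∈ bandLimited ℤ d)
  (hv : v ∈ bandLimited ℤ d) (hg : g ∈ bandLimited ℤ d) (hq : 4 * d + 1 ≤ q)

include hu hf hv hq in
lemma coeff_zero_rieszIncrement_mul_of_lt (hg₀ : g.coeff 0 = 0) {k j : ℕ} (hkj : k < j) :
    (rieszIncrement q u f k * rieszIncrement q v g j).coeff 0 = 0 := by
  have hd : (d : ℝ) ≤ 1 / 4 * (q - 1) := by
    have : (4 * d + 1 : ℝ) ≤ q := by exact_mod_cast hq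
    linarith
  have h_pow : (q : ℝ) ^ (k + 1) ≤ q ^ j := by
    gcongr
    · exact_mod_cast (by lia : 1 ≤ q)
    · exact hkj
  have h_pos : (0 : ℝ) ≤ q ^ j := by positivity
  have h_band := mul_mem_bandLimited (rieszIncrement_mem_bandLimited hu hf hd k)
    (rieszProd_mem_bandLimited hv hd j)
  rw [rieszIncrement.eq_def q v, ← mul_assoc, coeff_zero_mul_pullback_phase h_band (by linarith),
    hg₀, mul_zero]

include hu hv hq in
lemma coeff_zero_rieszIncrement_mul_self (k : ℕ) :
    (rieszIncrement q u f k * rieszIncrement q v g k).coeff 0 =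
      (u * v).coeff 0 ^ k * (f * g).coeff 0 := by
  have hd : 2 * (d + d : ℝ) + 1 ≤ q := by exact_mod_cast (by lia : 2 * (d + d) + 1 ≤ q)
  have huv := mul_mem_bandLimited hu hv
  have h_band := rieszProd_mem_bandLimited (q := q) (δ := 1 / 2) huv (by linarith) k
  have h_pow : (0 : ℝ) ≤ q ^ k := by positivity
  have h_mul : rieszIncrement q u f k * rieszIncrement q v g k =
      rieszProd q (u * v) k * pullback (phase q k) (f * g) := by
    rw [rieszIncrement, rieszIncrement, rieszProd_mul, map_mul]
    ring
  rw [h_mul, coeff_zero_mul_pullback_phase h_band (by linarith), coeff_zero_rieszProd huv hd]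

include hu hf hv hg hq in
lemma coeff_zero_sum_rieszIncrement_mul_sum (hf₀ : f.coeff 0 = 0) (hg₀ : g.coeff 0 = 0)
    (a b : ℕ → ℂ) (n : ℕ) :
    ((∑ k ∈ range n, a k • rieszIncrement q u f k) *
        ∑ j ∈ range n, b j • rieszIncrement q v g j).coeff 0 =
      ∑ k ∈ range n, a k * b k * ((u * v).coeff 0 ^ k * (f * g).coeff 0) := by
  simp only [sum_mul_sum, smul_mul_smul_comm, coeff_sum, coeff_smul, Finsupp.finsetSum_apply,
    Finsupp.smul_apply, smul_eq_mul]
  refine sum_congr rfl fun k hk => ?_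
  rw [sum_eq_single_of_mem k hk, coeff_zero_rieszIncrement_mul_self hu hv hq]
  intro j _ hjk
  obtain hjk | hkj := hjk.lt_or_gt
  · rw [mul_comm (rieszIncrement q u f k),
      coeff_zero_rieszIncrement_mul_of_lt hv hg hu hq hf₀ hjk, mul_zero]
  · rw [coeff_zero_rieszIncrement_mul_of_lt hu hf hv hq hg₀ hkj, mul_zero]

end Orthogonality

section Potential

variable {ℓ ℓ' : ℤ × ℤ →+ ℤ} {ε ε' : ℤˣ} {κ B A : ℝ} {K S : ℂ[ℤ]}
  (hℓ : ∀ j k, ℓ (phase q j k) = (ε * q) ^ j * k)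
  (hℓ' : ∀ j k, ℓ' (phase q j k) = (ε' * q) ^ j * k)

lemma abs_cast_units_mul_pow (ε : ℤˣ) (q j : ℕ) :
    |(((ε * q : ℤ) ^ j : ℤ) : ℝ)| = (q : ℝ) ^ j := by
  rw [← Int.cast_abs, abs_pow, abs_mul, Int.abs_natCast, Int.isUnit_iff_abs_eq.1 ε.isUnit]
  push_cast
  ring

include hℓ hℓ' in
lemma isTame_rieszProd (hK : IsTame (.id ℤ) (.id ℤ) B K) (hκ : 0 ≤ κ) (hq : B ≤ κ * (q - 1))
    (j : ℕ) : IsTame ℓ ℓ' (κ * q ^ j) (rieszProd q K j) := by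
  refine (IsTame.prod (range j) (C := fun i => B * (q : ℝ) ^ i) fun i _ => ?_).mono ?_
  · rw [mul_comm]
    exact hK.pullback (hℓ i) (hℓ' i) (abs_cast_units_mul_pow ε q i).le
      (abs_cast_units_mul_pow ε' q i).le
  · refine (sum_range_mul_pow_le q.cast_nonneg hq j).trans ?_
    gcongr
    linarith

include hℓ hℓ' in
lemma l1Norm_deriv_deriv_rieszIncrement_sub_le {d : ℕ} (hK : IsKernel d K)
    (hqd : 2 * d + 1 ≤ q) (hKB : IsTame (.id ℤ) (.id ℤ) B K) (hκ : 0 ≤ κ) (hqB : B ≤ κ * (q - 1))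
    (hS : ∀ χ, ‖evalChar χ S‖ ≤ A) (hDS : ∀ χ, ‖evalChar χ (charDeriv (.id ℤ) S)‖ ≤ A) (j : ℕ) :
    l1Norm (charDeriv ℓ (charDeriv ℓ' (rieszIncrement q K S j)) -
        ((q : ℂ) ^ (2 * j) * (ε * ε') ^ j) •
          rieszIncrement q K (charDeriv (.id ℤ) (charDeriv (.id ℤ) S)) j) ≤
      q ^ (2 * j) * (A * (2 * κ + κ ^ 2)) := by
  have h := l1Norm_le_mul_of_norm_le fun χ => norm_evalChar_deriv_mul_pullback_sub_le
    (hℓ j) (hℓ' j) (abs_cast_units_mul_pow ε q j).le (abs_cast_units_mul_pow ε' q j).le hS hDS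
    (isTame_rieszProd hℓ hℓ' hKB hκ hqB j) χ
  rw [hK.l1Norm_rieszProd hqd, mul_one, ← pow_mul'] at h
  have h_scale : (q : ℂ) ^ (2 * j) * (ε * ε') ^ j =
      (((ε * q : ℤ) ^ j : ℤ) : ℂ) * (((ε' * q : ℤ) ^ j : ℤ) : ℂ) := by
    push_cast
    ring
  rwa [h_scale, rieszIncrement, rieszIncrement]

/-- A lacunary sum whose second derivatives along the coordinates are, up to signs and a small
error, sums of the Riesz increments of the second derivative of `S`. -/
def rieszPotential (q : ℕ) (K S : ℂ[ℤ]) (n : ℕ) : ℂ[ℤ × ℤ] :=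
  ∑ j ∈ range n, ((q : ℂ) ^ (2 * j))⁻¹ • rieszIncrement q K S j

include hℓ hℓ' in
lemma l1Norm_deriv_deriv_rieszPotential_sub_le {d : ℕ} (hK : IsKernel d K)
    (hqd : 2 * d + 1 ≤ q) (hKB : IsTame (.id ℤ) (.id ℤ) B K) (hκ : 0 ≤ κ) (hqB : B ≤ κ * (q - 1))
    (hS : ∀ χ, ‖evalChar χ S‖ ≤ A) (hDS : ∀ χ, ‖evalChar χ (charDeriv (.id ℤ) S)‖ ≤ A) (n : ℕ) :
    l1Norm (charDeriv ℓ (charDeriv ℓ' (rieszPotential q K S n)) -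
        ∑ j ∈ range n, (ε * ε' : ℂ) ^ j •
          rieszIncrement q K (charDeriv (.id ℤ) (charDeriv (.id ℤ) S)) j) ≤
      n * (A * (2 * κ + κ ^ 2)) := by
  have hq : 0 < (q : ℝ) := by exact_mod_cast (by lia : 0 < q)
  have hq₀ : (q : ℂ) ≠ 0 := by exact_mod_cast hq.ne'
  have h_term (j : ℕ) : l1Norm (charDeriv ℓ (charDeriv ℓ' (((q : ℂ) ^ (2 * j))⁻¹ •
      rieszIncrement q K S j)) - (ε * ε' : ℂ) ^ j •
        rieszIncrement q K (charDeriv (.id ℤ) (charDeriv (.id ℤ) S)) j) ≤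
      A * (2 * κ + κ ^ 2) := by
    rw [Derivation.map_smul, Derivation.map_smul,
      ← inv_mul_cancel_left₀ (pow_ne_zero (2 * j) hq₀) ((ε * ε' : ℂ) ^ j), mul_smul, ← smul_sub,
      map_smul_eq_mul, norm_inv, norm_pow, Complex.norm_natCast, inv_mul_le_iff₀ (by positivity)]
    exact l1Norm_deriv_deriv_rieszIncrement_sub_le hℓ hℓ' hK hqd hKB hκ hqB hS hDS j
  simp only [rieszPotential, map_sum, ← sum_sub_distrib]
  refine (le_sum_of_subadditive l1Norm (map_zero l1Norm).le (map_add_le_add _) _ _).trans ?_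
  simpa using sum_le_sum fun j (_ : j ∈ range n) => h_term j

end Potential

end RieszProducts

section Kernel

/-- The Fejér kernel `∑_{|k| ≤ m} (1 - |k| / (m + 1)) e_k`. -/
def fejer (m : ℕ) : ℂ[ℤ] :=
  (m + 1 : ℂ)⁻¹ • ((∑ i ∈ Ico (0 : ℤ) (m + 1), single i 1) *
    ∑ j ∈ Ico (0 : ℤ) (m + 1), single (-j) 1)

lemma evalChar_fejer_nonneg (m : ℕ) (χ : AddChar ℤ Circle) : 0 ≤ evalChar χ (fejer m) := by
  have h_conj : evalChar χ (∑ j ∈ Ico (0 : ℤ) (m + 1), single (-j) 1) =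
      starRingEnd ℂ (evalChar χ (∑ i ∈ Ico (0 : ℤ) (m + 1), single i 1)) := by
    simp only [map_sum, evalChar_single, one_mul, AddChar.map_neg_eq_inv, Circle.coe_inv_eq_conj]
  rw [fejer, map_smul, map_mul, h_conj, smul_eq_mul]
  exact mul_nonneg (inv_nonneg.2 (by positivity)) (mul_star_self_nonneg _)

lemma coeff_fejer (m : ℕ) (k : ℤ) :
    (fejer m).coeff k =
      (m + 1 : ℂ)⁻¹ * #{j ∈ Ico (0 : ℤ) (m + 1) | k + j ∈ Ico (0 : ℤ) (m + 1)} := by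
  have h_coeff (j : ℤ) :
      ((∑ i ∈ Ico (0 : ℤ) (m + 1), single i (1 : ℂ)) * single (-j) 1).coeff k =
        if k + j ∈ Ico (0 : ℤ) (m + 1) then 1 else 0 := by
    simp only [coeff_mul_single_apply, coeff_sum, coeff_single, Finsupp.finsetSum_apply,
      Finsupp.single_apply, sum_ite_eq', neg_neg, mul_one]
  rw [fejer, mul_sum, coeff_smul, coeff_sum, Finsupp.smul_apply, Finsupp.finsetSum_apply,
    sum_congr rfl fun j _ => h_coeff j, sum_boole, smul_eq_mul]

lemma coeff_fejer_zero (m : ℕ) : (fejer m).coeff 0 = 1 := by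
  have h : (m + 1 : ℂ) ≠ 0 := m.cast_add_one_ne_zero
  rw [coeff_fejer, filter_true_of_mem (by simp), Int.card_Ico]
  simpa using inv_mul_cancel₀ h

lemma coeff_fejer_one (m : ℕ) : (fejer m).coeff 1 = m / (m + 1) := by
  have h : {j ∈ Ico (0 : ℤ) (m + 1) | 1 + j ∈ Ico (0 : ℤ) (m + 1)} = Ico (0 : ℤ) m := by grind
  rw [coeff_fejer, h, Int.card_Ico, div_eq_inv_mul]
  simp

lemma coeff_fejer_neg_one (m : ℕ) : (fejer m).coeff (-1) = m / (m + 1) := by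
  have h : {j ∈ Ico (0 : ℤ) (m + 1) | -1 + j ∈ Ico (0 : ℤ) (m + 1)} = Ico (1 : ℤ) (m + 1) := by
    grind
  rw [coeff_fejer, h, Int.card_Ico, div_eq_inv_mul]
  simp

lemma norm_coeff_fejer_le_one (m : ℕ) (k : ℤ) : ‖(fejer m).coeff k‖ ≤ 1 := by
  have h_card : (#{j ∈ Ico (0 : ℤ) (m + 1) | k + j ∈ Ico (0 : ℤ) (m + 1)} : ℝ) ≤ m + 1 := by
    exact_mod_cast (card_filter_le _ _).trans (by simp)
  have h_norm : ‖(m + 1 : ℂ)‖ = m + 1 := by exact_mod_cast Complex.norm_natCast (m + 1)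
  rw [coeff_fejer, norm_mul, norm_inv, h_norm, Complex.norm_natCast]
  exact inv_mul_le_one_of_le₀ h_card (by positivity)

lemma fejer_mem_bandLimited (m : ℕ) : fejer m ∈ bandLimited ℤ m := by
  refine mem_bandLimited.2 fun k hk => ?_
  rw [Int.norm_eq_abs, ← Int.cast_abs, ← Int.cast_natCast, Int.cast_lt] at hk
  rw [coeff_fejer, filter_false_of_mem (by grind)]
  simp

/-- The Fejér kernel, averaged with the constant `1` so as to be bounded away from zero. -/
def posFejer (m : ℕ) : ℂ[ℤ] :=
  (m / (m + 1) : ℂ) • fejer m + (m + 1 : ℂ)⁻¹ • 1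

lemma coeff_posFejer_zero (m : ℕ) : (posFejer m).coeff 0 = 1 := by
  have h : (m + 1 : ℂ) ≠ 0 := m.cast_add_one_ne_zero
  rw [posFejer, coeff_add, coeff_smul, coeff_smul, Finsupp.add_apply, Finsupp.smul_apply,
    Finsupp.smul_apply, coeff_fejer_zero, one_def, coeff_single, Finsupp.single_eq_same,
    smul_eq_mul, smul_eq_mul]
  field_simp

lemma coeff_posFejer_of_ne_zero (m : ℕ) {k : ℤ} (hk : k ≠ 0) :
    (posFejer m).coeff k = m / (m + 1) * (fejer m).coeff k := by
  simp [posFejer, coeff_one_of_ne_zero hk]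

lemma coeff_posFejer_one (m : ℕ) : (posFejer m).coeff 1 = (m / (m + 1)) ^ 2 := by
  rw [coeff_posFejer_of_ne_zero m one_ne_zero, coeff_fejer_one, sq]

lemma coeff_posFejer_neg_one (m : ℕ) : (posFejer m).coeff (-1) = (m / (m + 1)) ^ 2 := by
  rw [coeff_posFejer_of_ne_zero m (by simp), coeff_fejer_neg_one, sq]

lemma norm_coeff_posFejer_le_one (m : ℕ) (k : ℤ) : ‖(posFejer m).coeff k‖ ≤ 1 := by
  obtain rfl | hk := eq_or_ne k 0
  · simp [coeff_posFejer_zero]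
  · have h : ‖(m / (m + 1) : ℂ)‖ ≤ 1 := by
      rw [← coeff_fejer_one]
      exact norm_coeff_fejer_le_one m 1
    rw [coeff_posFejer_of_ne_zero m hk, norm_mul]
    exact mul_le_one₀ h (norm_nonneg _) (norm_coeff_fejer_le_one m k)

lemma inv_le_evalChar_posFejer (m : ℕ) (χ : AddChar ℤ Circle) :
    (m + 1 : ℂ)⁻¹ ≤ evalChar χ (posFejer m) := by
  have h : 0 ≤ (m / (m + 1) : ℂ) * evalChar χ (fejer m) :=
    mul_nonneg (div_nonneg (by positivity) (by positivity)) (evalChar_fejer_nonneg m χ)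
  simpa [posFejer] using h

lemma isKernel_posFejer (m : ℕ) : IsKernel m (posFejer m) where
  nonneg χ := (inv_nonneg.2 (by positivity)).trans (inv_le_evalChar_posFejer m χ)
  coeff_zero := coeff_posFejer_zero m
  mem_bandLimited := add_mem (Submodule.smul_mem _ _ (fejer_mem_bandLimited m))
    (Submodule.smul_mem _ _ (one_mem_bandLimited m.cast_nonneg))

lemma inv_le_norm_evalChar_posFejer (m : ℕ) (χ : AddChar ℤ Circle) :
    (m + 1 : ℝ)⁻¹ ≤ ‖evalChar χ (posFejer m)‖ := by
  have h : (((m + 1 : ℝ)⁻¹ : ℝ) : ℂ) ≤ evalChar χ (posFejer m) := by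
    simpa using inv_le_evalChar_posFejer m χ
  rwa [Complex.eq_coe_norm_of_nonneg ((isKernel_posFejer m).nonneg χ), Complex.real_le_real] at h

lemma isTame_posFejer (m : ℕ) :
    IsTame (.id ℤ) (.id ℤ) (2 * (m + 1) ^ 3 : ℝ) (posFejer m) := by
  have h_band := (isKernel_posFejer m).mem_bandLimited
  have h_band' := charDeriv_mem_bandLimited (.id ℤ) h_band
  have h_coeff := norm_coeff_charDeriv_le_of_mem_bandLimited h_band (norm_coeff_posFejer_le_one m)
  have h_coeff' := norm_coeff_charDeriv_le_of_mem_bandLimited h_band' h_coeff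
  have h_one_le (χ : AddChar ℤ Circle) : 1 ≤ (m + 1) * ‖evalChar χ (posFejer m)‖ :=
    (inv_le_iff_one_le_mul₀' (by positivity)).1 (inv_le_norm_evalChar_posFejer m χ)
  have h_first (χ : AddChar ℤ Circle) : ‖evalChar χ (charDeriv (.id ℤ) (posFejer m))‖ ≤
      2 * (m + 1) ^ 3 * ‖evalChar χ (posFejer m)‖ := by
    calc
      _ ≤ (2 * m + 1 : ℝ) * (m * 1) := norm_evalChar_le_of_mem_bandLimited h_band' h_coeff χ
      _ ≤ 2 * (m + 1) ^ 2 * 1 := by nlinarith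
      _ ≤ 2 * (m + 1) ^ 2 * ((m + 1) * ‖evalChar χ (posFejer m)‖) := by gcongr; exact h_one_le χ
      _ = _ := by ring
  refine ⟨by positivity, h_first, h_first, fun χ => ?_⟩
  calc
    _ ≤ (2 * m + 1 : ℝ) * (m * (m * 1)) :=
      norm_evalChar_le_of_mem_bandLimited (charDeriv_mem_bandLimited _ h_band') h_coeff' χ
    _ ≤ 2 * (m + 1) ^ 3 * 1 := by
      have : (0 : ℝ) ≤ m := m.cast_nonneg
      nlinarith [sq_nonneg (m : ℝ)]
    _ ≤ 4 * (m + 1) ^ 5 * 1 := by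
      gcongr <;> norm_num
    _ ≤ 4 * (m + 1) ^ 5 * ((m + 1) * ‖evalChar χ (posFejer m)‖) := by gcongr; exact h_one_le χ
    _ = _ := by ring

/-- The mean-zero function with second derivative `posFejer m - 1`. The frequency `k = 0` is
discarded because `1 / 0 = 0`. -/
def posFejerPrimitive (m : ℕ) : ℂ[ℤ] :=
  multiplier (fun k : ℤ => -1 / (k : ℂ) ^ 2) (posFejer m)

lemma deriv_deriv_posFejerPrimitive (m : ℕ) :
    charDeriv (.id ℤ) (charDeriv (.id ℤ) (posFejerPrimitive m)) = posFejer m - 1 := by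
  ext k
  obtain rfl | hk := eq_or_ne k 0
  · simp [coeff_posFejer_zero]
  · have : (k : ℂ) ≠ 0 := by exact_mod_cast hk
    have h_symbol : Complex.I * k * (Complex.I * k * (-1 / (k : ℂ) ^ 2)) = 1 := by
      field_simp
      simp
    rw [coeff_charDeriv, coeff_charDeriv, posFejerPrimitive, coeff_multiplier, ← mul_assoc,
      ← mul_assoc, AddMonoidHom.id_apply, mul_assoc _ _ (-1 / _), h_symbol, coeff_sub,
      Finsupp.sub_apply, coeff_one_of_ne_zero hk, one_mul, sub_zero]

lemma norm_coeff_deriv_posFejerPrimitive_le_one (m : ℕ) (k : ℤ) :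
    ‖(charDeriv (.id ℤ) (posFejerPrimitive m)).coeff k‖ ≤ 1 := by
  obtain rfl | hk := eq_or_ne k 0
  · simp
  · have hk₀ : (k : ℂ) ≠ 0 := by exact_mod_cast hk
    have h_one : (1 : ℝ) ≤ |(k : ℝ)| := by exact_mod_cast Int.one_le_abs hk
    have h_symbol : Complex.I * k * (-1 / (k : ℂ) ^ 2) = -Complex.I / k := by field_simp
    rw [coeff_charDeriv, posFejerPrimitive, coeff_multiplier, ← mul_assoc, AddMonoidHom.id_apply,
      h_symbol, norm_mul, norm_div, norm_neg, Complex.norm_I, Complex.norm_intCast]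
    exact mul_le_one₀ (div_le_one_of_le₀ h_one (abs_nonneg _)) (norm_nonneg _)
      (norm_coeff_posFejer_le_one m k)

lemma norm_coeff_posFejerPrimitive_le_one (m : ℕ) (k : ℤ) :
    ‖(posFejerPrimitive m).coeff k‖ ≤ 1 := by
  obtain rfl | hk := eq_or_ne k 0
  · simp [posFejerPrimitive]
  · have h_one : (1 : ℝ) ≤ |(k : ℝ)| := by exact_mod_cast Int.one_le_abs hk
    refine le_trans ?_ (norm_coeff_deriv_posFejerPrimitive_le_one m k)
    rw [coeff_charDeriv, norm_mul, norm_mul, Complex.norm_I, one_mul, AddMonoidHom.id_apply,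
      Complex.norm_intCast]
    exact le_mul_of_one_le_left (norm_nonneg _) h_one

lemma posFejerPrimitive_mem_bandLimited (m : ℕ) : posFejerPrimitive m ∈ bandLimited ℤ m :=
  multiplier_mem_bandLimited _ (isKernel_posFejer m).mem_bandLimited

lemma norm_evalChar_posFejerPrimitive_le (m : ℕ) (χ : AddChar ℤ Circle) :
    ‖evalChar χ (posFejerPrimitive m)‖ ≤ 2 * m + 1 := by
  simpa using norm_evalChar_le_of_mem_bandLimited (posFejerPrimitive_mem_bandLimited m)
    (norm_coeff_posFejerPrimitive_le_one m) χ

lemma norm_evalChar_deriv_posFejerPrimitive_le (m : ℕ) (χ : AddChar ℤ Circle) :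
    ‖evalChar χ (charDeriv (.id ℤ) (posFejerPrimitive m))‖ ≤ 2 * m + 1 := by
  simpa using norm_evalChar_le_of_mem_bandLimited
    (charDeriv_mem_bandLimited _ (posFejerPrimitive_mem_bandLimited m))
    (norm_coeff_deriv_posFejerPrimitive_le_one m) χ

end Kernel

section TestFunction

variable {q : ℕ}

lemma abs_sum_neg_one_pow_mul_two_mul_succ_sub_le {a : ℕ → ℝ} (ha : Antitone a)
    (h_nonneg : ∀ k, 0 ≤ a k) (n : ℕ) :
    |∑ k ∈ range n, (-1) ^ k * (2 * a (k + 1) - a k)| ≤ 2 * a 0 := by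
  have h_abel : 2 * ∑ k ∈ range n, (-1) ^ k * (2 * a (k + 1) - a k) =
      a 0 - (-1) ^ n * a n - 3 * ∑ k ∈ range n, (-1) ^ k * (a k - a (k + 1)) := by
    induction n with
    | zero => simp
    | succ n ih => rw [sum_range_succ, sum_range_succ, mul_add, ih]; ring
  have h_variation : |∑ k ∈ range n, (-1) ^ k * (a k - a (k + 1))| ≤ a 0 - a n := by
    refine (abs_sum_le_sum_abs _ _).trans_eq ?_
    rw [← sum_range_sub']
    refine sum_congr rfl fun k _ => ?_
    rw [abs_mul, abs_neg_one_pow, one_mul, abs_of_nonneg (sub_nonneg.2 (ha k.le_succ))]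
  have h_last : |(-1) ^ n * a n| = a n := by
    rw [abs_mul, abs_neg_one_pow, one_mul, abs_of_nonneg (h_nonneg n)]
  have h_zero := h_nonneg n
  have h_antitone := ha n.zero_le
  grind

/-- The cosine `(e_1 + e_{-1}) / 2`. -/
def cosine : ℂ[ℤ] :=
  (1 / 2 : ℂ) • (single 1 1 + single (-1) 1)

/-- The function `(1 + cos) / 2`, with values in `[0, 1]`. -/
def halfOneAddCosine : ℂ[ℤ] :=
  (1 / 2 : ℂ) • (1 + cosine)

lemma evalChar_cosine (χ : AddChar ℤ Circle) : evalChar χ cosine = ((χ 1 : ℂ).re : ℂ) := by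
  rw [cosine, map_smul, map_add, evalChar_single, evalChar_single, AddChar.map_neg_eq_inv,
    Circle.coe_inv_eq_conj, Complex.re_eq_add_conj, smul_eq_mul]
  ring

lemma coeff_zero_cosine : cosine.coeff 0 = 0 := by
  simp [cosine, -LaurentPolynomial.single_eq_C_mul_T]

lemma coeff_zero_cosine_mul (f : ℂ[ℤ]) :
    (cosine * f).coeff 0 = (f.coeff 1 + f.coeff (-1)) / 2 := by
  simp only [cosine, smul_mul_assoc, add_mul, coeff_smul, coeff_add, Finsupp.smul_apply,
    Finsupp.add_apply, coeff_single_mul_apply, neg_neg, add_zero, one_mul, smul_eq_mul]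
  ring

lemma cosine_mem_bandLimited : cosine ∈ bandLimited ℤ 1 :=
  Submodule.smul_mem _ _ (add_mem (single_mem_bandLimited (by simp) 1)
    (single_mem_bandLimited (by simp) 1))

lemma halfOneAddCosine_mem_bandLimited : halfOneAddCosine ∈ bandLimited ℤ 1 :=
  Submodule.smul_mem _ _ (add_mem (one_mem_bandLimited zero_le_one) cosine_mem_bandLimited)

/-- The factor `(1 + cos) / 2` makes the increments `W_k cos = 2 W_{k+1} - W_k` of a decreasing
sequence, so that the alternating sum stays bounded. -/
lemma norm_evalChar_sum_rieszIncrement_cosine_le (q n : ℕ) (χ : AddChar (ℤ × ℤ) Circle) :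
    ‖evalChar χ (∑ k ∈ range n, (-1 : ℂ) ^ k • rieszIncrement q halfOneAddCosine cosine k)‖ ≤
      2 := by
  let c (i : ℕ) : ℝ := (χ (phase q i 1) : ℂ).re
  let W (k : ℕ) : ℝ := ∏ i ∈ range k, (1 + c i) / 2
  have h_cos (i : ℕ) : evalChar χ (pullback (phase q i) cosine) = c i := by
    rw [evalChar_pullback, evalChar_cosine]
    rfl
  have h_prod (k : ℕ) : evalChar χ (rieszProd q halfOneAddCosine k) = W k := by
    simp only [rieszProd, halfOneAddCosine, W, map_prod, map_smul, map_add, map_one, h_cos,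
      Complex.ofReal_prod]
    refine prod_congr rfl fun i _ => ?_
    push_cast
    rw [smul_eq_mul]
    ring
  have h_abs (i : ℕ) : |c i| ≤ 1 := (Complex.abs_re_le_norm _).trans (Circle.norm_coe _).le
  have h_nonneg (k : ℕ) : 0 ≤ W k :=
    prod_nonneg fun i _ => by linarith [(abs_le.1 (h_abs i)).1]
  have h_succ (k : ℕ) : W (k + 1) = W k * ((1 + c k) / 2) := prod_range_succ ..
  have h_antitone : Antitone W := antitone_nat_of_succ_le fun k => by
    rw [h_succ]
    exact mul_le_of_le_one_right (h_nonneg k) (by linarith [(abs_le.1 (h_abs k)).2])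
  have h_real : evalChar χ
      (∑ k ∈ range n, (-1 : ℂ) ^ k • rieszIncrement q halfOneAddCosine cosine k) =
      ((∑ k ∈ range n, (-1) ^ k * (2 * W (k + 1) - W k) : ℝ) : ℂ) := by
    simp only [rieszIncrement, map_sum, map_smul, map_mul, h_prod, h_cos, h_succ, smul_eq_mul]
    push_cast
    exact sum_congr rfl fun k _ => by ring
  rw [h_real, Complex.norm_real, Real.norm_eq_abs]
  simpa [W] using abs_sum_neg_one_pow_mul_two_mul_succ_sub_le h_antitone h_nonneg n

/-- Pairing with the bounded function of `norm_evalChar_sum_rieszIncrement_cosine_le`. -/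
lemma IsKernel.sum_le_two_mul_l1Norm {K : ℂ[ℤ]} {d : ℕ} {a : ℝ} (hK : IsKernel d K) (hd : 1 ≤ d)
    (hq : 4 * d + 1 ≤ q) (h_one : K.coeff 1 = a) (h_neg_one : K.coeff (-1) = a) (n : ℕ) :
    ∑ k ∈ range n, ((1 + a) / 2) ^ k * a ≤
      2 * l1Norm (∑ k ∈ range n, (-1 : ℂ) ^ k • rieszIncrement q K (K - 1) k) := by
  have hd : (1 : ℝ) ≤ d := by exact_mod_cast hd
  have h_cos_mul : (cosine * (K - 1)).coeff 0 = a := by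
    rw [mul_sub, mul_one, coeff_sub, Finsupp.sub_apply, coeff_zero_cosine_mul, coeff_zero_cosine,
      h_one, h_neg_one]
    ring
  have h_half_mul : (halfOneAddCosine * K).coeff 0 = (1 + a) / 2 := by
    rw [halfOneAddCosine, smul_mul_assoc, add_mul, one_mul, coeff_smul, coeff_add,
      Finsupp.smul_apply, Finsupp.add_apply, coeff_zero_cosine_mul, hK.coeff_zero, h_one, h_neg_one,
      smul_eq_mul]
    ring
  have h_orth := coeff_zero_sum_rieszIncrement_mul_sum
    (bandLimited_mono hd halfOneAddCosine_mem_bandLimited)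
    (bandLimited_mono hd cosine_mem_bandLimited) hK.mem_bandLimited
    (sub_mem hK.mem_bandLimited (one_mem_bandLimited d.cast_nonneg)) hq coeff_zero_cosine
    (by simp [hK.coeff_zero]) (fun k => (-1) ^ k) (fun k => (-1) ^ k) n
  have h_real : ((∑ k ∈ range n, ((1 + a) / 2) ^ k * a : ℝ) : ℂ) = ((∑ k ∈ range n,
      (-1 : ℂ) ^ k • rieszIncrement q halfOneAddCosine cosine k) *
        ∑ k ∈ range n, (-1 : ℂ) ^ k • rieszIncrement q K (K - 1) k).coeff 0 := by
    rw [h_orth, h_half_mul, h_cos_mul]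
    push_cast
    simp only [← mul_pow, neg_mul_neg, one_mul, one_pow]
  refine (le_abs_self _).trans ?_
  rw [← Real.norm_eq_abs, ← Complex.norm_real, h_real]
  exact norm_coeff_zero_mul_le (norm_evalChar_sum_rieszIncrement_cosine_le q n)

lemma one_sixth_le_pow_mul {n k : ℕ} (hkn : k < n) {r : ℝ}
    (hr : 1 - 1 / (2 * n + 1) = r) : 1 / 6 ≤ ((1 + r ^ 2) / 2) ^ k * r ^ 2 := by
  have hn : (1 : ℝ) ≤ n := by exact_mod_cast (by lia : 1 ≤ n)
  have hk : (k : ℝ) ≤ n := by exact_mod_cast hkn.le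
  have h_inv : (1 : ℝ) / (2 * n + 1) ≤ 1 / 3 := by gcongr; linarith
  have h_pow : 1 / 2 ≤ ((1 + r ^ 2) / 2) ^ k := by
    calc
      (1 / 2 : ℝ) ≤ 1 - n / (2 * n + 1) := by
        rw [le_sub_comm, div_le_iff₀ (by positivity)]
        linarith
      _ ≤ 1 + k * (r - 1) := by
        rw [← hr, sub_sub_cancel_left, mul_neg, mul_one_div, ← sub_eq_add_neg]
        gcongr
      _ ≤ r ^ k := by simpa using one_add_mul_le_pow (by linarith : -2 ≤ r - 1) k
      _ ≤ ((1 + r ^ 2) / 2) ^ k := by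
        gcongr
        · linarith
        · nlinarith [sq_nonneg (r - 1)]
  calc
    (1 / 6 : ℝ) ≤ 1 / 2 * (1 / 3) := by norm_num
    _ ≤ ((1 + r ^ 2) / 2) ^ k * r ^ 2 := by
      gcongr
      nlinarith

lemma div_twelve_le_l1Norm_sum_rieszIncrement_posFejer {n : ℕ} (hq : 8 * n + 1 ≤ q) :
    (n / 12 : ℝ) ≤ l1Norm (∑ k ∈ range n, (-1 : ℂ) ^ k •
      rieszIncrement q (posFejer (2 * n)) (posFejer (2 * n) - 1) k) := by
  obtain rfl | hn := n.eq_zero_or_pos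
  · simp
  set r : ℝ := (2 * n : ℕ) / ((2 * n : ℕ) + 1) with hr
  have h_r : 1 - 1 / (2 * n + 1) = r := by
    rw [hr]
    push_cast
    field_simp
    ring
  have h_one : (posFejer (2 * n)).coeff 1 = (r ^ 2 : ℝ) := by simp [hr, coeff_posFejer_one]
  have h_neg_one : (posFejer (2 * n)).coeff (-1) = (r ^ 2 : ℝ) := by
    simp [hr, coeff_posFejer_neg_one]
  have h_dual := (isKernel_posFejer (2 * n)).sum_le_two_mul_l1Norm (q := q) (by lia) (by lia)
    h_one h_neg_one n
  have h_sum := card_nsmul_le_sum (range n) _ _ fun k hk =>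
    one_sixth_le_pow_mul (mem_range.1 hk) h_r
  rw [card_range, nsmul_eq_mul] at h_sum
  linarith

end TestFunction

section Extremal

/-- The ratio of consecutive frequencies in the Riesz products with `n` factors. The fifth power
makes the total of the `n` errors in the second derivatives at most one. -/
def rieszRatio (n : ℕ) : ℕ := 12 * (2 * n + 1) ^ 5 + 1

/-- The Riesz potential whose mixed derivative is large compared with its pure second
derivatives. Its Riesz products are built from the Fejér kernel of degree `2 n`. -/
def fejerPotential (n : ℕ) : ℂ[ℤ × ℤ] :=
  rieszPotential (rieszRatio n) (posFejer (2 * n)) (posFejerPrimitive (2 * n)) n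

lemma eight_mul_add_one_le_rieszRatio (n : ℕ) : 8 * n + 1 ≤ rieszRatio n := by
  have : 2 * n + 1 ≤ (2 * n + 1) ^ 5 := Nat.le_self_pow (by simp) _
  rw [rieszRatio]
  lia

lemma rieszRatio_pow_le_exp (n : ℕ) : (rieszRatio n : ℝ) ^ n ≤ Real.exp (16 * n ^ 2) := by
  obtain rfl | hn := n.eq_zero_or_pos
  · simp
  have h_one : (1 : ℝ) ≤ n := by exact_mod_cast hn
  have h_const : (13 : ℝ) ≤ Real.exp (3 * n) := by
    calc (13 : ℝ)
      _ ≤ (2.7 : ℝ) ^ 3 := by norm_num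
      _ ≤ Real.exp 1 ^ 3 := by gcongr; linarith [Real.exp_one_gt_d9]
      _ = Real.exp 3 := by rw [← Real.exp_nat_mul]; norm_num
      _ ≤ Real.exp (3 * n) := by gcongr; linarith
  have h_base : (rieszRatio n : ℝ) ≤ Real.exp (16 * n) := by
    calc (rieszRatio n : ℝ)
      _ = 12 * (2 * n + 1) ^ 5 + 1 := by push_cast [rieszRatio]; rfl
      _ ≤ 13 * (2 * n + 1) ^ 5 := by
        linarith [one_le_pow₀ (n := 5) (by linarith : (1 : ℝ) ≤ 2 * n + 1)]
      _ ≤ Real.exp (3 * n) * Real.exp (2 * n) ^ 5 := by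
        gcongr
        exact Real.add_one_le_exp _
      _ = Real.exp (13 * n) := by rw [← Real.exp_nat_mul, ← Real.exp_add]; congr 1; push_cast; ring
      _ ≤ Real.exp (16 * n) := by gcongr; norm_num
  calc (rieszRatio n : ℝ) ^ n
    _ ≤ Real.exp (16 * n) ^ n := by gcongr
    _ = Real.exp (16 * n ^ 2) := by rw [← Real.exp_nat_mul]; congr 1; ring

lemma fejerPotential_mem_bandLimited (n : ℕ) :
    fejerPotential n ∈ bandLimited (ℤ × ℤ) (1 / 2 * (rieszRatio n ^ n - 1)) := by
  have hq : (8 * n + 1 : ℝ) ≤ rieszRatio n := by exact_mod_cast eight_mul_add_one_le_rieszRatio n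
  have h_degree : ((2 * n : ℕ) : ℝ) ≤ 1 / 2 * (rieszRatio n - 1) := by
    push_cast
    linarith
  refine Submodule.sum_mem _ fun j hj => Submodule.smul_mem _ _ (bandLimited_mono ?_
    (rieszIncrement_mem_bandLimited (isKernel_posFejer _).mem_bandLimited
      (posFejerPrimitive_mem_bandLimited _) h_degree j))
  gcongr
  · linarith
  · exact mem_range.1 hj

lemma l1Norm_deriv_deriv_fejerPotential_sub_le {ℓ ℓ' : ℤ × ℤ →+ ℤ} {ε ε' : ℤˣ} (n : ℕ)
    (hℓ : ∀ j k, ℓ (phase (rieszRatio n) j k) = (ε * rieszRatio n) ^ j * k)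
    (hℓ' : ∀ j k, ℓ' (phase (rieszRatio n) j k) = (ε' * rieszRatio n) ^ j * k) :
    l1Norm (charDeriv ℓ (charDeriv ℓ' (fejerPotential n)) -
      ∑ j ∈ range n, (ε * ε' : ℂ) ^ j •
        rieszIncrement (rieszRatio n) (posFejer (2 * n)) (posFejer (2 * n) - 1) j) ≤ 1 := by
  set M : ℝ := 2 * n + 1 with hM
  have hM₁ : 1 ≤ M := by simp [hM]
  have h_ratio : 2 * (2 * n) + 1 ≤ rieszRatio n := by linarith [eight_mul_add_one_le_rieszRatio n]
  have h_scale : 2 * ((2 * n : ℕ) + 1 : ℝ) ^ 3 ≤ 1 / (6 * M ^ 2) * (rieszRatio n - 1) := by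
    push_cast [rieszRatio]
    rw [← hM]
    field_simp
    linarith
  have h := l1Norm_deriv_deriv_rieszPotential_sub_le hℓ hℓ' (isKernel_posFejer (2 * n))
    h_ratio (isTame_posFejer (2 * n)) (by positivity)
    h_scale (norm_evalChar_posFejerPrimitive_le (2 * n))
    (norm_evalChar_deriv_posFejerPrimitive_le (2 * n)) n
  rw [deriv_deriv_posFejerPrimitive] at h
  refine h.trans ?_
  calc
    _ ≤ M / 2 * (2 * M * (2 * (1 / (6 * M ^ 2)) + 1 / (6 * M ^ 2))) := by
      gcongr
      · linarith
      · push_cast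
        linarith
      · have h_small : 1 / (6 * M ^ 2) ≤ 1 := (div_le_one (by positivity)).2 (by nlinarith)
        exact pow_le_of_le_one (by positivity) h_small two_ne_zero
    _ ≤ 1 := by
      field_simp
      norm_num

lemma l1Norm_deriv_deriv_fejerPotential_le {ℓ : ℤ × ℤ →+ ℤ} {ε : ℤˣ} (n : ℕ)
    (hℓ : ∀ j k, ℓ (phase (rieszRatio n) j k) = (ε * rieszRatio n) ^ j * k) :
    l1Norm (charDeriv ℓ (charDeriv ℓ (fejerPotential n))) ≤ 3 := by
  set q := rieszRatio n
  set K := posFejer (2 * n)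
  have h_error := l1Norm_deriv_deriv_fejerPotential_sub_le n hℓ hℓ
  have h_sign : (ε * ε : ℂ) = 1 := by
    exact_mod_cast congrArg (Int.cast ∘ Units.val) (Int.units_mul_self ε)
  have h_telescope : ∑ j ∈ range n, (ε * ε : ℂ) ^ j • rieszIncrement q K (K - 1) j =
      rieszProd q K n - rieszProd q K 0 := by
    simp only [h_sign, one_pow, one_smul, ← rieszProd_succ_sub, sum_range_sub]
  have h_prod (j : ℕ) : l1Norm (rieszProd q K j) = 1 :=
    (isKernel_posFejer _).l1Norm_rieszProd (by linarith [eight_mul_add_one_le_rieszRatio n]) j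
  rw [h_telescope] at h_error
  have h_main := map_sub_le_add l1Norm (rieszProd q K n) (rieszProd q K 0)
  rw [h_prod, h_prod] at h_main
  linarith [le_map_add_map_sub l1Norm (charDeriv ℓ (charDeriv ℓ (fejerPotential n)))
    (rieszProd q K n - rieszProd q K 0)]

lemma le_l1Norm_derivX_derivY_fejerPotential (n : ℕ) :
    n / 12 - 1 ≤ l1Norm (derivX (derivY (fejerPotential n))) := by
  have h_error := l1Norm_deriv_deriv_fejerPotential_sub_le n (fst_phase _) (snd_phase _)
  have h_main :=
    div_twelve_le_l1Norm_sum_rieszIncrement_posFejer (eight_mul_add_one_le_rieszRatio n)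
  have h_sign : (((1 : ℤˣ) : ℤ) * ((-1 : ℤˣ) : ℤ) : ℂ) = -1 := by simp
  rw [h_sign, map_sub_rev] at h_error
  linarith [le_map_add_map_sub l1Norm
    (∑ j ∈ range n, (-1 : ℂ) ^ j •
      rieszIncrement (rieszRatio n) (posFejer (2 * n)) (posFejer (2 * n) - 1) j)
    (derivX (derivY (fejerPotential n)))]

/-- The potential of `n` increments, normalized and corrected by a monomial which makes the degree
equal to `N`. -/
def extremalPoly (n N : ℕ) : ℂ[ℤ × ℤ] :=
  (1 / 8 : ℂ) • fejerPotential n + single ((N, N) : ℤ × ℤ) (1 / (8 * N ^ 2) : ℂ)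

variable {n N : ℕ}

lemma norm_diag_natCast (N : ℕ) : ‖((N, N) : ℤ × ℤ)‖ = N := by
  simp [Prod.norm_def]

lemma fejerPotential_mem_bandLimited_of_pow_le (h : rieszRatio n ^ n ≤ N) :
    fejerPotential n ∈ bandLimited (ℤ × ℤ) (N / 2) := by
  have h : (rieszRatio n ^ n : ℝ) ≤ N := by exact_mod_cast h
  exact bandLimited_mono (by linarith) (fejerPotential_mem_bandLimited n)

lemma coeff_fejerPotential_diag (hN : 1 ≤ N) (h : rieszRatio n ^ n ≤ N) :
    (fejerPotential n).coeff (N, N) = 0 := by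
  refine mem_bandLimited.1 (fejerPotential_mem_bandLimited_of_pow_le h) _ ?_
  rw [norm_diag_natCast]
  exact half_lt_self (by exact_mod_cast hN)

lemma trigDegree_extremalPoly (hN : 1 ≤ N) (h : rieszRatio n ^ n ≤ N) :
    trigDegree (extremalPoly n N).coeff = N := by
  refine le_antisymm (trigDegree_le_of_mem_bandLimited ?_) ?_
  · have h_half : (N / 2 : ℝ) ≤ N := half_le_self N.cast_nonneg
    exact add_mem (Submodule.smul_mem _ _
      (bandLimited_mono h_half (fejerPotential_mem_bandLimited_of_pow_le h)))
      (single_mem_bandLimited (norm_diag_natCast N).le _)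
  · have h_support : ((N, N) : ℤ × ℤ) ∈ (extremalPoly n N).coeff.support := by
      simpa [extremalPoly, coeff_fejerPotential_diag hN h] using Nat.ne_zero_of_lt hN
    simpa [trigDegree] using
      Finset.le_sup (f := fun k : ℤ × ℤ => max k.1.natAbs k.2.natAbs) h_support

lemma deriv_deriv_extremalPoly {ℓ ℓ' : ℤ × ℤ →+ ℤ} (hN : 1 ≤ N) (hℓ : ℓ (N, N) = N)
    (hℓ' : ℓ' (N, N) = N) :
    charDeriv ℓ (charDeriv ℓ' (extremalPoly n N)) =
      (1 / 8 : ℂ) • charDeriv ℓ (charDeriv ℓ' (fejerPotential n)) +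
        single ((N, N) : ℤ × ℤ) (-1 / 8) := by
  have hN₀ : (N : ℂ) ≠ 0 := by exact_mod_cast Nat.ne_zero_of_lt hN
  have h_coeff : Complex.I * N * (Complex.I * N * (1 / (8 * N ^ 2))) = -1 / 8 := by
    field_simp
    exact Complex.I_sq
  simp only [extremalPoly, map_add, Derivation.map_smul, charDeriv_single, hℓ, hℓ',
    Int.cast_natCast, h_coeff]

lemma l1Norm_deriv_deriv_extremalPoly_le {ℓ : ℤ × ℤ →+ ℤ} {ε : ℤˣ} (hN : 1 ≤ N)
    (hℓ : ∀ j k, ℓ (phase (rieszRatio n) j k) = (ε * rieszRatio n) ^ j * k)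
    (hℓN : ℓ (N, N) = N) :
    l1Norm (charDeriv ℓ (charDeriv ℓ (extremalPoly n N))) ≤ 1 / 2 := by
  rw [deriv_deriv_extremalPoly hN hℓN hℓN]
  refine (map_add_le_add l1Norm _ _).trans ?_
  have h_norm : ‖(1 / 8 : ℂ)‖ = 1 / 8 ∧ ‖(-1 / 8 : ℂ)‖ = 1 / 8 := by norm_num
  rw [map_smul_eq_mul, l1Norm_single, h_norm.1, h_norm.2]
  linarith [l1Norm_deriv_deriv_fejerPotential_le n hℓ]

lemma le_l1Norm_derivX_derivY_extremalPoly (hN : 1 ≤ N) (h : rieszRatio n ^ n ≤ N) :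
    (n + 1) / 400 ≤ l1Norm (derivX (derivY (extremalPoly n N))) := by
  rw [deriv_deriv_extremalPoly hN rfl rfl]
  set D := derivX (derivY (fejerPotential n)) with hD
  have h_norm : ‖(1 / 8 : ℂ)‖ = 1 / 8 ∧ ‖(-1 / 8 : ℂ)‖ = 1 / 8 := by norm_num
  have h_coeff :
      ((1 / 8 : ℂ) • D + single ((N, N) : ℤ × ℤ) (-1 / 8 : ℂ)).coeff (N, N) = -1 / 8 := by
    simp [hD, coeff_fejerPotential_diag hN h]
  have h_monomial := norm_coeff_le_l1Norm
    ((1 / 8 : ℂ) • D + single ((N, N) : ℤ × ℤ) (-1 / 8 : ℂ)) (N, N)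
  have h_potential := le_l1Norm_derivX_derivY_fejerPotential n
  have h_triangle := le_map_add_map_sub l1Norm ((1 / 8 : ℂ) • D)
    (-single ((N, N) : ℤ × ℤ) (-1 / 8 : ℂ))
  rw [sub_neg_eq_add, map_neg_eq_map, l1Norm_single, map_smul_eq_mul, h_norm.1,
    h_norm.2] at h_triangle
  rw [h_coeff, h_norm.2] at h_monomial
  linarith

lemma exists_rieszRatio_pow_le (hN : 1 ≤ N) :
    ∃ n : ℕ, rieszRatio n ^ n ≤ N ∧ √(Real.log N) / 4 < n + 1 := by
  refine ⟨⌊√(Real.log N) / 4⌋₊, ?_, Nat.lt_floor_add_one _⟩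
  set n := ⌊√(Real.log N) / 4⌋₊
  have hN₀ : (0 : ℝ) < N := by exact_mod_cast hN
  have h_sqrt : (4 * n : ℝ) ≤ √(Real.log N) := by
    linarith [Nat.floor_le (by positivity : 0 ≤ √(Real.log N) / 4)]
  have h_log : (16 * n ^ 2 : ℝ) ≤ Real.log N := by
    calc (16 * n ^ 2 : ℝ)
      _ = (4 * n) ^ 2 := by ring
      _ ≤ Real.log N := (Real.le_sqrt (by positivity) (Real.log_natCast_nonneg N)).1 h_sqrt
  have h_exp := (rieszRatio_pow_le_exp n).trans ((Real.le_log_iff_exp_le hN₀).1 h_log)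
  exact_mod_cast h_exp

end Extremal

end

theorem corollary1 :
    ∃ C : ℝ, 0 < C ∧ ∀ N : ℕ, 1 ≤ N → ∃ P : TrigPoly2,
      trigDegree P = N ∧
      normL1 (partialX (partialX (trigFun P))) + normL1 (partialY (partialY (trigFun P))) ≤ 1 ∧
      ENNReal.ofReal (C * Real.log (N : ℝ) ^ (1 / 2 : ℝ)) <
        normL1 (partialX (partialY (trigFun P))) := by
  refine ⟨1 / 1600, by norm_num, fun N hN => ?_⟩
  obtain ⟨n, h_pow, h_sqrt⟩ := exists_rieszRatio_pow_le hN
  refine ⟨(extremalPoly n N).coeff, trigDegree_extremalPoly hN h_pow, ?_, ?_⟩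
  · have hX := l1Norm_deriv_deriv_extremalPoly_le hN (fst_phase (rieszRatio n)) rfl
    have hY := l1Norm_deriv_deriv_extremalPoly_le hN (snd_phase (rieszRatio n)) rfl
    rw [partialX_trigFun, partialX_trigFun, partialY_trigFun, partialY_trigFun, normL1_trigFun,
      normL1_trigFun, ← ENNReal.ofReal_add (apply_nonneg _ _) (apply_nonneg _ _),
      ENNReal.ofReal_le_one]
    linarith
  · have hXY := le_l1Norm_derivX_derivY_extremalPoly hN h_pow
    rw [partialY_trigFun, partialX_trigFun, normL1_trigFun, ← Real.sqrt_eq_rpow]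
    exact (ENNReal.ofReal_lt_ofReal_iff_of_nonneg (by positivity)).2 (by linarith)
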